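/- Let $\mathbb K$ be an algebraically closed field of characteristic zero, let $m,n$ be natural numbers and let $0\le\mu_1\le\dots\le\mu_m\le n$ be integers. Let $\mathcal L\subset \mathrm{Mat}_{m\times n}(\mathbb K)$ be the lower left filled linear space of type $\mu=(\mu_1,\dots,\mu_m)$, that is, the linear span of the matrix units $E_{i,j}$ with $1\le i\le m$ and $1\le j\le\mu_i$. Let $\mathrm{Grass}(m,\mathbb K^{m+n})\subset\mathbb P(\wedge^m\mathbb K^{m+n})$ be the Grassmannian of $m$-dimensional subspaces in its Plücker embedding, and let $\bar{\mathcal L}$ be the projective (Zariski) closure in $\mathbb P(\wedge^m\mathbb K^{m+n})$ of the image of $\mathcal L$ under $F\mapsto \mathrm{rowsp}\,[I_m\mid F]$. For a complete flag $\mathcal F:\ 0=V_0\subset V_1\subset\dots\subset V_{m+n}=\mathbb K^{m+n}$ with $\dim V_q=q$, and for $1\le\nu_1<\dots<\nu_m\le m+n$, let $$S_{\mathcal F}(\nu_1,\dots,\nu_m)=\{W\in\mathrm{Grass}(m,\mathbb K^{m+n})\mid \dim(W\cap V_{\nu_k})\ge k,\ k=1,\dots,m\}$$ be the Schubert variety,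 regarded as a subset of $\mathbb P(\wedge^m\mathbb K^{m+n})$. (1) For every complete flag $\mathcal F$, $\bar{\mathcal L}$ is isomorphic, as a projective variety, to $S_{\mathcal F}(\mu_1+1,\mu_2+2,\dots,\mu_m+m)$. (2) The isomorphism is induced by a column permutation: there is a permutation $\sigma$ of $\{1,\dots,m+n\}$ such that for every complete flag $\mathcal F$ and every basis $b_1,\dots,b_{m+n}$ of $\mathbb K^{m+n}$ compatible with it (i.e. $V_q=\mathrm{span}(b_1,\dots,b_q)$ for all $q$), the automorphism of $\mathbb P(\wedge^m\mathbb K^{m+n})$ induced by the linear automorphism $x\mapsto\sum_j x_j b_{\sigma(j)}$ of $\mathbb K^{m+n}$ restricts to an isomorphism of $\bar{\mathcal L}$ onto $S_{\mathcal F}(\mu_1+1,\dots,\mu_m+m)$. In particular, for the standard flag and the standard basis the isomorphism is induced by the permutation $\sigma$ of the columns. -/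

import Mathlib

open scoped LinearAlgebra.Projectivization

noncomputable section

namespace SchubertCompactification

section ProjectiveGeometry

variable {K V W : Type*} [Field K] [AddCommGroup V] [Module K V] [AddCommGroup W] [Module K W]

/-- The value at `v : V` of a polynomial in linear forms on `V`. The variables are all linear forms
on `V`, so these are exactly the polynomial functions on `V`, and with respect to any system of
linear coordinates on a finite-dimensional `V` the homogeneous polynomials of degree `d` give
exactly the functions which are homogeneous polynomials of degree `d` in the coordinates. -/
def evalForm (F : MvPolynomial (Module.Dual K V) K) (v : V) : K :=
  MvPolynomial.eval (fun φ : Module.Dual K V => φ v) F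

/-- A polynomial (meant to be homogeneous) vanishes at a point of projective space. -/
def VanishesAt (F : MvPolynomial (Module.Dual K V) K) (p : ℙ K V) : Prop :=
  evalForm F p.rep = 0

/-- The projective (Zariski) closure of a set of points of `ℙ(V)`: all common zeros of the
homogeneous polynomials which vanish on the set. -/
def projectiveClosure (X : Set (ℙ K V)) : Set (ℙ K V) :=
  {p | ∀ (d : ℕ) (F : MvPolynomial (Module.Dual K V) K), F.IsHomogeneous d →
    (∀ q ∈ X, VanishesAt F q) → VanishesAt F p}

/-- Regular maps (morphisms of varieties) between subsets of projective spaces, with their reduced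
structure: near each point `p` of `X`, that is on a basic Zariski open neighbourhood `G ≠ 0` of `p`
in `X`, the map is `q ↦ [∑ i, F i (q) • w i]` for homogeneous polynomials `F i` of one common
degree (the components of a homogeneous polynomial map to `W`) without common zero there. -/
def IsRegularMap {X : Set (ℙ K V)} {Y : Set (ℙ K W)} (f : X → Y) : Prop :=
  ∀ p : X, ∃ (c : ℕ) (G : MvPolynomial (Module.Dual K V) K),
    G.IsHomogeneous c ∧ ¬ VanishesAt G (p : ℙ K V) ∧
    ∃ (d r : ℕ) (F : Fin r → MvPolynomial (Module.Dual K V) K) (w : Fin r → W),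
      (∀ i, (F i).IsHomogeneous d) ∧
      ∀ q : X, ¬ VanishesAt G (q : ℙ K V) →
        ∃ h : ∑ i, evalForm (F i) (q : ℙ K V).rep • w i ≠ 0,
          (f q : ℙ K W) = Projectivization.mk K (∑ i, evalForm (F i) (q : ℙ K V).rep • w i) h

/-- A bijection which is an isomorphism of projective varieties: regular in both directions. -/
def IsIsomorphism {X : Set (ℙ K V)} {Y : Set (ℙ K W)} (e : X ≃ Y) : Prop :=
  IsRegularMap (e : X → Y) ∧ IsRegularMap (e.symm : Y → X)

/-- Two subsets of projective spaces are isomorphic as projective varieties. -/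
def AreIsomorphic (X : Set (ℙ K V)) (Y : Set (ℙ K W)) : Prop :=
  ∃ e : X ≃ Y, IsIsomorphism e

end ProjectiveGeometry

section Grassmannian

variable (K : Type*) [Field K]

/-- `Grass(m, K^N)`: the `m`-dimensional linear subspaces of `K^N`. -/
def Grass (m N : ℕ) : Type _ :=
  {U : Submodule K (Fin N → K) // Module.finrank K U = m}

/-- The space `ℙ(⋀^m K^N)`. -/
abbrev PluckerSpace (m N : ℕ) : Type _ := ℙ K (⋀[K]^m (Fin N → K))

variable {K}

/-- The subspace `⋀^m U` of `⋀^m K^N`. -/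
def exteriorPowerSubspace (m : ℕ) {N : ℕ} (U : Submodule K (Fin N → K)) :
    Submodule K (⋀[K]^m (Fin N → K)) :=
  LinearMap.range (exteriorPower.map m U.subtype)

theorem finrank_exteriorPowerSubspace {m N : ℕ} (U : Grass K m N) :
    Module.finrank K (exteriorPowerSubspace m U.1) = 1 := by
  have hinj : Function.Injective (exteriorPower.map m U.1.subtype) :=
    exteriorPower.map_injective_field (by simp)
  rw [exteriorPowerSubspace, LinearMap.finrank_range_of_inj hinj, exteriorPower.finrank_eq, U.2,
    Nat.choose_self]

/-- The Plücker embedding `Grass(m, K^N) → ℙ(⋀^m K^N)`, `U ↦ ⋀^m U`. -/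
def plucker {m N : ℕ} (U : Grass K m N) : PluckerSpace K m N :=
  Projectivization.mk'' (exteriorPowerSubspace m U.1) (finrank_exteriorPowerSubspace U)

/-- The automorphism of `ℙ(⋀^m K^N)` induced by a linear automorphism of `K^N`. -/
def inducedMap (m : ℕ) {N : ℕ} (g : (Fin N → K) ≃ₗ[K] (Fin N → K)) :
    PluckerSpace K m N → PluckerSpace K m N :=
  Projectivization.map (exteriorPower.map m (g : (Fin N → K) →ₗ[K] (Fin N → K)))
    (exteriorPower.map_injective_field g.injective)

/-- A complete flag `V_0 = {0} ⊂ V_1 ⊂ ⋯ ⊂ V_N = K^N` with `dim V_q = q` for `q ≤ N`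
(the values with index larger than `N` are then forced to be `K^N`). -/
structure CompleteFlag (K : Type*) [Field K] (N : ℕ) where
  V : ℕ → Submodule K (Fin N → K)
  mono : Monotone V
  finrank_eq : ∀ q, q ≤ N → Module.finrank K (V q) = q

/-- The basis `b_1, …, b_N` is compatible with the flag: `V_q` is spanned by `b_1, …, b_q`. -/
def CompleteFlag.IsCompatible {N : ℕ} (𝓕 : CompleteFlag K N)
    (b : Module.Basis (Fin N) K (Fin N → K)) : Prop :=
  ∀ q, q ≤ N → 𝓕.V q = Submodule.span K {x | ∃ i : Fin N, (i : ℕ) < q ∧ x = b i}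

/-- The Schubert variety `S(ν_1, …, ν_m)` with respect to a flag, as a subset of projective space
through the Plücker embedding; the index `k : Fin m` stands for the `(k+1)`-st condition
`dim (U ∩ V_{ν_{k+1}}) ≥ k+1`. -/
def schubertVariety {m N : ℕ} (𝓕 : CompleteFlag K N) (ν : Fin m → ℕ) :
    Set (PluckerSpace K m N) :=
  plucker '' {U : Grass K m N |
    ∀ k : Fin m, (k : ℕ) + 1 ≤ Module.finrank K (U.1 ⊓ 𝓕.V (ν k) : Submodule K (Fin N → K))}

/-- The `m × (m+n)` matrix `[I_m | F]`. -/
def augment {m n : ℕ} (F : Matrix (Fin m) (Fin n) K) : Matrix (Fin m) (Fin (m + n)) K :=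
  (Matrix.fromCols (1 : Matrix (Fin m) (Fin m) K) F).submatrix id finSumFinEquiv.symm

theorem linearIndependent_augment {m n : ℕ} (F : Matrix (Fin m) (Fin n) K) :
    LinearIndependent K (augment F).row := by
  rw [Fintype.linearIndependent_iff]
  intro g hg i
  have h := congrFun hg (Fin.castAdd n i)
  simpa [augment, Matrix.row, Finset.sum_apply, Matrix.one_apply] using h

/-- The point `rowsp [I_m | F]` of `Grass(m, K^(m+n))`. -/
def rowspAugment {m n : ℕ} (F : Matrix (Fin m) (Fin n) K) : Grass K m (m + n) :=
  ⟨Submodule.span K (Set.range (augment F).row), by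
    simpa using finrank_span_eq_card (linearIndependent_augment F)⟩

/-- The compactification of a linear space `𝓛` of `m × n` matrices: the projective closure in
`ℙ(⋀^m K^(m+n))` of the image of `𝓛` under `F ↦ rowsp [I_m | F]`. -/
def compactification {m n : ℕ} (𝓛 : Submodule K (Matrix (Fin m) (Fin n) K)) :
    Set (PluckerSpace K m (m + n)) :=
  projectiveClosure ((fun F => plucker (rowspAugment F)) '' (𝓛 : Set (Matrix (Fin m) (Fin n) K)))

/-- `𝓛` is the lower left filled linear space of type `μ`: `μ` is nondecreasing with values in
`{0, …, n}`, and `𝓛` is spanned by the matrix units `E_{i,j}` with `j ≤ μ_i` (in the numbering of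
the columns by `1, …, n`). -/
structure IsLowerLeftFilled {m n : ℕ} (μ : Fin m → ℕ)
    (𝓛 : Submodule K (Matrix (Fin m) (Fin n) K)) : Prop where
  mono : Monotone μ
  le : ∀ i, μ i ≤ n
  eq_span : 𝓛 = Submodule.span K
    {A | ∃ (i : Fin m) (j : Fin n), (j : ℕ) + 1 ≤ μ i ∧ A = Matrix.single i j (1 : K)}

/-- The linear automorphism of `K^N` that moves the `j`-th coordinate of a row vector to position
`σ j` and then reads the resulting coordinates in the basis `b`: `x ↦ ∑ j, x_j • b_{σ j}`. If `b` is
the standard basis, this is the permutation `σ` of the columns. -/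
def columnPermutation {N : ℕ} (σ : Equiv.Perm (Fin N))
    (b : Module.Basis (Fin N) K (Fin N → K)) : (Fin N → K) ≃ₗ[K] (Fin N → K) :=
  (Pi.basisFun K (Fin N)).equiv b σ

end Grassmannian

end SchubertCompactification

end

open SchubertCompactification

open SchubertCompactification
open scoped LinearAlgebra.Projectivization

namespace SchubertCompactification

/-! ### Linear maps, projective closure and regular maps -/

section ProjectiveGeometry

variable {K V W : Type*} [Field K] [AddCommGroup V] [Module K V] [AddCommGroup W] [Module K W]

/-! Permute the columns of `[I_m | F]` so that the identity columns land at the pivot positions and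
the other columns keep their order. A free column then lies to the right of the `i`-th pivot exactly
when type `μ` forces its entry in row `i` to vanish. So the image of `𝓛` becomes the open Schubert
cell of reduced echelon matrices (`inducedMap_image_eq_schubertCell`). Linear automorphisms commute
with projective closure and restrict to isomorphisms, so it remains to show that the closure of the
cell is the Schubert variety.

The Schubert variety lies in the closure: a member has a basis `w` with `w k` in the `k`-th flag
step, an echelon family some of whose pivots may vanish. Nonzero pivots give a point of the cell. A
zero pivot is the value at `t = 0` of a line on which it equals `t`, and a polynomial vanishing for
all `t ≠ 0` vanishes at `0` (`evalForm_ιMulti_eq_zero`).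

The closure lies in the Schubert variety: the determinantal relations pass to the closure and make
its points decomposable (`ιMulti_pluckerRow`). The vanishing of Plücker coordinates with too many
indices beyond a pivot also passes, and forces the dimension conditions
(`le_finrank_inf_of_pluckerCoord`). -/

theorem evalForm_smul {F : MvPolynomial (Module.Dual K V) K} {d : ℕ} (hF : F.IsHomogeneous d)
    (a : K) (v : V) : evalForm F (a • v) = a ^ d * evalForm F v := by
  simp only [evalForm, MvPolynomial.eval_eq, Finset.mul_sum]
  refine Finset.sum_congr rfl fun e he => ?_
  have hd := hF.degree_eq_sum_deg_support he
  simp only [map_smul, smul_eq_mul, mul_pow, Finset.prod_mul_distrib, Finset.prod_pow_eq_pow_sum]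
  rw [← hd]
  ring

theorem vanishesAt_mk {F : MvPolynomial (Module.Dual K V) K} {d : ℕ} (hF : F.IsHomogeneous d)
    (v : V) (hv : v ≠ 0) : VanishesAt F (Projectivization.mk K v hv) ↔ evalForm F v = 0 := by
  obtain ⟨a, ha⟩ := Projectivization.exists_smul_eq_mk_rep K v hv
  rw [VanishesAt, ← ha, Units.smul_def, evalForm_smul hF]
  simp

theorem evalForm_rename (L : V →ₗ[K] W) (F : MvPolynomial (Module.Dual K W) K) (v : V) :
    evalForm (MvPolynomial.rename (fun φ : Module.Dual K W => φ ∘ₗ L) F) v = evalForm F (L v) := by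
  simp [evalForm, MvPolynomial.eval_rename, Function.comp_def]

theorem vanishesAt_rename {L : V →ₗ[K] W} (hL : Function.Injective L)
    {F : MvPolynomial (Module.Dual K W) K} {d : ℕ} (hF : F.IsHomogeneous d) (p : ℙ K V) :
    VanishesAt (MvPolynomial.rename (fun φ : Module.Dual K W => φ ∘ₗ L) F) p ↔
      VanishesAt F (Projectivization.map L hL p) := by
  induction p using Projectivization.ind with
  | h v hv =>
    rw [vanishesAt_mk hF.rename_isHomogeneous, Projectivization.map_mk, vanishesAt_mk hF,
      evalForm_rename]

/-- Forms pull back along `L` by renaming each variable `φ` to `φ ∘ L`, which preserves the degree.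
-/
theorem map_mem_projectiveClosure {L : V →ₗ[K] W} (hL : Function.Injective L) {X : Set (ℙ K V)}
    {p : ℙ K V} (hp : p ∈ projectiveClosure X) :
    Projectivization.map L hL p ∈ projectiveClosure (Projectivization.map L hL '' X) := by
  intro d F hF hX
  rw [← vanishesAt_rename hL hF]
  refine hp d _ hF.rename_isHomogeneous fun q hq => ?_
  rw [vanishesAt_rename hL hF]
  exact hX _ ⟨q, hq, rfl⟩

/-- The bijection of projective spaces induced by a linear equivalence. -/
noncomputable def projectivizationEquiv (L : V ≃ₗ[K] W) : ℙ K V ≃ ℙ K W where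
  toFun := Projectivization.map (L : V →ₗ[K] W) L.injective
  invFun := Projectivization.map (L.symm : W →ₗ[K] V) L.symm.injective
  left_inv p := by
    induction p using Projectivization.ind with
    | h v hv => simp [Projectivization.map_mk]
  right_inv p := by
    induction p using Projectivization.ind with
    | h v hv => simp [Projectivization.map_mk]

theorem projectivizationEquiv_image_projectiveClosure (L : V ≃ₗ[K] W) (X : Set (ℙ K V)) :
    projectivizationEquiv L '' projectiveClosure X =
      projectiveClosure (projectivizationEquiv L '' X) := by
  apply Set.Subset.antisymm
  · rintro _ ⟨p, hp, rfl⟩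
    exact map_mem_projectiveClosure L.injective hp
  · intro p hp
    refine ⟨(projectivizationEquiv L).symm p, ?_, Equiv.apply_symm_apply _ _⟩
    have h := map_mem_projectiveClosure (L := (L.symm : W →ₗ[K] V)) L.symm.injective hp
    rw [← Set.image_comp] at h
    convert! h
    symm
    convert! Set.image_id X
    ext1 q
    exact (projectivizationEquiv L).symm_apply_apply q

theorem isRegularMap_of_linear [FiniteDimensional K W] (L : V →ₗ[K] W)
    (hL : Function.Injective L) {X : Set (ℙ K V)} {Y : Set (ℙ K W)} (f : X → Y)
    (hf : ∀ q, (f q : ℙ K W) = Projectivization.map L hL q) : IsRegularMap f := by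
  intro p
  -- One global chart suffices (`G = 1`): the forms are the coordinates of `L` in a basis of `W`.
  refine ⟨0, 1, MvPolynomial.isHomogeneous_one _ _, by simp [VanishesAt, evalForm], 1,
    Module.finrank K W, fun i => MvPolynomial.X ((Module.finBasis K W).coord i ∘ₗ L),
    Module.finBasis K W, fun i => MvPolynomial.isHomogeneous_X _ _, fun q _ => ?_⟩
  have hsum : ∑ i, evalForm (MvPolynomial.X ((Module.finBasis K W).coord i ∘ₗ L))
      (q : ℙ K V).rep • Module.finBasis K W i = L (q : ℙ K V).rep := by
    simp only [evalForm, MvPolynomial.eval_X, LinearMap.comp_apply, Module.Basis.coord_apply]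
    exact (Module.finBasis K W).sum_repr _
  simp only [hsum]
  refine ⟨by simpa using hL.ne (q : ℙ K V).rep_nonzero, ?_⟩
  rw [hf, ← Projectivization.map_mk L hL _ (q : ℙ K V).rep_nonzero, Projectivization.mk_rep]

theorem exists_isIsomorphism_of_image_eq [FiniteDimensional K V] [FiniteDimensional K W]
    (L : V ≃ₗ[K] W) {X : Set (ℙ K V)} {Y : Set (ℙ K W)}
    (hXY : projectivizationEquiv L '' X = Y) :
    ∃ e : X ≃ Y, IsIsomorphism e ∧ ∀ p : X, (e p : ℙ K W) = projectivizationEquiv L p := by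
  subst hXY
  refine ⟨(projectivizationEquiv L).image X, ⟨?_, ?_⟩, fun p => rfl⟩
  · exact isRegularMap_of_linear (L : V →ₗ[K] W) L.injective _ fun q => rfl
  · refine isRegularMap_of_linear (L.symm : W →ₗ[K] V) L.symm.injective _ fun q => ?_
    obtain ⟨q, rfl⟩ := ((projectivizationEquiv L).image X).surjective q
    rw [Equiv.symm_apply_apply]
    exact ((projectivizationEquiv L).symm_apply_apply _).symm

/-- A homogeneous polynomial restricted to a line is a polynomial function of the parameter. -/
theorem exists_polynomial_eval_eq_evalForm (F : MvPolynomial (Module.Dual K V) K) (u v : V) :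
    ∃ P : Polynomial K, ∀ t : K, P.eval t = evalForm F (u + t • v) := by
  refine ⟨MvPolynomial.aeval (fun φ : Module.Dual K V =>
    Polynomial.C (φ u) + Polynomial.X * Polynomial.C (φ v)) F, fun t => ?_⟩
  rw [evalForm, ← Polynomial.coe_evalRingHom, ← MvPolynomial.coe_aeval_eq_eval,
    MvPolynomial.aeval_def, MvPolynomial.hom_eval₂]
  simp only [RingHom.coe_coe, MvPolynomial.aeval_def]
  congr 1
  · ext x
    simp
  · ext φ
    simp only [map_add, map_mul, Polynomial.coe_evalRingHom, Polynomial.eval_C,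
      Polynomial.eval_X, map_smul, smul_eq_mul]

/-- This replaces the limit `t → 0`: a one-variable polynomial with infinitely many roots is zero.
-/
theorem evalForm_eq_zero_of_punctured_line [Infinite K] (F : MvPolynomial (Module.Dual K V) K)
    (u v : V) (h : ∀ t : K, t ≠ 0 → evalForm F (u + t • v) = 0) : evalForm F u = 0 := by
  obtain ⟨P, hP⟩ := exists_polynomial_eval_eq_evalForm F u v
  have hP0 : P = 0 := by
    refine Polynomial.eq_zero_of_infinite_isRoot P ?_
    refine Set.Infinite.mono (s := {0}ᶜ) (fun t ht => ?_) (Set.finite_singleton (0 : K)).infinite_compl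
    change P.eval t = 0
    rw [hP]
    exact h t ht
  simpa [hP0] using (hP 0).symm

end ProjectiveGeometry

/-! ### Plücker coordinates and decomposability -/

section PluckerCoordinates

/-- This is Cramer's rule: pairing row `i` of the adjugate with column `j` of `A` puts that column
in place `i` of the minor. -/
theorem adjugate_submatrix_mul_apply {R ι κ : Type*} [CommRing R] [Fintype ι]
    [DecidableEq ι] (A : Matrix ι κ R) (I : ι → κ) (i : ι) (j : κ) :
    ((A.submatrix id I).adjugate * A) i j = (A.submatrix id (Function.update I i j)).det := by
  have h : A.submatrix id (Function.update I i j) =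
      (A.submatrix id I).updateCol i (fun l => A l j) := by
    ext l k
    by_cases hk : k = i
    · subst hk
      simp
    · simp [hk]
  rw [h, ← Matrix.cramer_apply, Matrix.cramer_eq_adjugate_mulVec]
  rfl

/-- Take determinants in `A_I * (adj A_I * A_J) = det A_I • A_J`. Keeping the factor `det A_I` on
both sides avoids the exponent `m - 1`, so `m = 0` needs no separate case. -/
theorem det_pow_mul_det_submatrix {R ι κ : Type*} [CommRing R] [Fintype ι]
    [DecidableEq ι] (A : Matrix ι κ R) (I J : ι → κ) :
    (A.submatrix id I).det ^ Fintype.card ι * (A.submatrix id J).det =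
      (A.submatrix id I).det *
        (Matrix.of fun i j => (A.submatrix id (Function.update I i (J j))).det).det := by
  have h : (Matrix.of fun i j => (A.submatrix id (Function.update I i (J j))).det) =
      (A.submatrix id I).adjugate * A.submatrix id J := by
    ext i j
    rw [Matrix.of_apply, ← adjugate_submatrix_mul_apply]
    rfl
  rw [h, Matrix.det_mul, ← mul_assoc, ← Matrix.det_mul, Matrix.mul_adjugate, Matrix.det_smul,
    Matrix.det_one, mul_one]

variable {K : Type*} [Field K] {m N : ℕ}

/-- The coordinates of a family of vectors with respect to a basis, as a matrix. -/
noncomputable def coordMatrix (b : Module.Basis (Fin N) K (Fin N → K)) (w : Fin m → Fin N → K) :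
    Matrix (Fin m) (Fin N) K :=
  Matrix.of fun i j => b.repr (w i) j

theorem coordMatrix_apply (b : Module.Basis (Fin N) K (Fin N → K)) (w : Fin m → Fin N → K)
    (i : Fin m) (j : Fin N) : coordMatrix b w i j = b.repr (w i) j := rfl

/-- The Plücker coordinate with respect to a basis and an arbitrary family of column indices. -/
noncomputable def pluckerCoord (b : Module.Basis (Fin N) K (Fin N → K)) (I : Fin m → Fin N) :
    Module.Dual K (⋀[K]^m (Fin N → K)) :=
  exteriorPower.alternatingMapToDual K (Fin N → K) m fun j => b.coord (I j)

theorem pluckerCoord_ιMulti (b : Module.Basis (Fin N) K (Fin N → K)) (I : Fin m → Fin N)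
    (w : Fin m → Fin N → K) :
    pluckerCoord b I (exteriorPower.ιMulti K m w) = ((coordMatrix b w).submatrix id I).det := by
  rw [pluckerCoord, exteriorPower.alternatingMapToDual_apply_ιMulti]
  rfl

/-- The coordinates with increasing `I` already form the dual basis of the exterior power. -/
theorem eq_of_pluckerCoord_eq (b : Module.Basis (Fin N) K (Fin N → K))
    {u v : ⋀[K]^m (Fin N → K)} (h : ∀ I, pluckerCoord b I u = pluckerCoord b I v) : u = v := by
  refine (b.exteriorPower m).ext_elem fun s => ?_
  rw [exteriorPower.basis_repr_apply, exteriorPower.basis_repr_apply]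
  have hs : exteriorPower.ιMultiDual K m b s =
      pluckerCoord b fun j => Set.powersetCard.ofFinEmbEquiv.symm s j := by
    refine exteriorPower.linearMap_ext (AlternatingMap.ext fun w => ?_)
    simp only [LinearMap.compAlternatingMap_apply]
    rw [exteriorPower.ιMultiDual_apply_ιMulti, pluckerCoord_ιMulti]
    rfl
  rw [hs, h]

theorem linearIndependent_of_ιMulti_ne_zero {w : Fin m → Fin N → K}
    (h : exteriorPower.ιMulti K m w ≠ 0) : LinearIndependent K w := by
  by_contra hw
  exact h (AlternatingMap.map_linearDependent _ _ hw)

theorem ιMulti_ne_zero {w : Fin m → Fin N → K} (hw : LinearIndependent K w) :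
    exteriorPower.ιMulti K m w ≠ 0 := by
  let s : Set.powersetCard (Fin m) m := Set.powersetCard.ofFinEmbEquiv (RelEmbedding.refl _)
  have h := (exteriorPower.ιMulti_family_linearIndependent_field m hw).ne_zero s
  rw [exteriorPower.ιMulti_family, Equiv.symm_apply_apply] at h
  exact h

theorem plucker_eq_mk (U : Grass K m N) {w : Fin m → Fin N → K}
    (hw : Submodule.span K (Set.range w) = U.1) (h : exteriorPower.ιMulti K m w ≠ 0) :
    plucker U = Projectivization.mk K (exteriorPower.ιMulti K m w) h := by
  apply Projectivization.submodule_injective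
  rw [plucker, Projectivization.submodule_mk'', Projectivization.submodule_mk]
  symm
  refine Submodule.eq_of_le_of_finrank_eq ?_ ?_
  · rw [Submodule.span_singleton_le_iff_mem]
    let w' : Fin m → U.1 := fun i => ⟨w i, hw ▸ Submodule.subset_span ⟨i, rfl⟩⟩
    have hw' : exteriorPower.map m U.1.subtype (exteriorPower.ιMulti K m w') =
        exteriorPower.ιMulti K m w := exteriorPower.map_apply_ιMulti _ _
    rw [← hw']
    exact LinearMap.mem_range_self _ _
  · rw [finrank_span_singleton h, finrank_exteriorPowerSubspace]

/-- The determinantal relations between the Plücker coordinates. -/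
noncomputable def pluckerRelation (b : Module.Basis (Fin N) K (Fin N → K))
    (I J : Fin m → Fin N) : MvPolynomial (Module.Dual K (⋀[K]^m (Fin N → K))) K :=
  MvPolynomial.X (pluckerCoord b I) ^ m * MvPolynomial.X (pluckerCoord b J) -
    MvPolynomial.X (pluckerCoord b I) * (Matrix.of fun i j =>
      MvPolynomial.X (pluckerCoord b (Function.update I i (J j)))).det

theorem isHomogeneous_pluckerRelation (b : Module.Basis (Fin N) K (Fin N → K))
    (I J : Fin m → Fin N) : (pluckerRelation b I J).IsHomogeneous (m + 1) := by
  refine MvPolynomial.IsHomogeneous.sub ?_ ?_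
  · exact (MvPolynomial.isHomogeneous_X_pow _ _).mul (MvPolynomial.isHomogeneous_X _ _)
  · rw [add_comm m 1]
    refine (MvPolynomial.isHomogeneous_X _ _).mul ?_
    rw [Matrix.det_apply]
    refine MvPolynomial.IsHomogeneous.sum _ _ _ fun τ _ => ?_
    have h : (∏ i : Fin m, (Matrix.of fun i j =>
        (MvPolynomial.X (pluckerCoord b (Function.update I i (J j))) :
          MvPolynomial (Module.Dual K (⋀[K]^m (Fin N → K))) K)) (τ i) i).IsHomogeneous m := by
      have h := MvPolynomial.IsHomogeneous.prod Finset.univ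
        (fun i : Fin m => (MvPolynomial.X (pluckerCoord b (Function.update I (τ i) (J i))) :
          MvPolynomial (Module.Dual K (⋀[K]^m (Fin N → K))) K)) (fun _ => 1)
        fun i _ => MvPolynomial.isHomogeneous_X _ _
      simpa using h
    rcases Int.units_eq_one_or (Equiv.Perm.sign τ) with hτ | hτ
    · simpa [hτ] using h
    · simpa [hτ] using h.neg

theorem evalForm_pluckerRelation (b : Module.Basis (Fin N) K (Fin N → K)) (I J : Fin m → Fin N)
    (v : ⋀[K]^m (Fin N → K)) : evalForm (pluckerRelation b I J) v =
      pluckerCoord b I v ^ m * pluckerCoord b J v - pluckerCoord b I v *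
        (Matrix.of fun i j => pluckerCoord b (Function.update I i (J j)) v).det := by
  simp only [evalForm, pluckerRelation, map_sub, map_mul, map_pow, MvPolynomial.eval_X,
    RingHom.map_det]
  congr 3
  ext i j
  simp

theorem evalForm_pluckerRelation_ιMulti (b : Module.Basis (Fin N) K (Fin N → K))
    (I J : Fin m → Fin N) (w : Fin m → Fin N → K) :
    evalForm (pluckerRelation b I J) (exteriorPower.ιMulti K m w) = 0 := by
  rw [evalForm_pluckerRelation, sub_eq_zero]
  simp only [pluckerCoord_ιMulti]
  simpa using det_pow_mul_det_submatrix (coordMatrix b w) I J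

/-- The row vectors read off from the Plücker coordinates of a point, relative to the indices `I`. -/
noncomputable def pluckerRow (b : Module.Basis (Fin N) K (Fin N → K)) (I : Fin m → Fin N)
    (v : ⋀[K]^m (Fin N → K)) (i : Fin m) : Fin N → K :=
  ∑ j, pluckerCoord b (Function.update I i j) v • b j

theorem repr_pluckerRow (b : Module.Basis (Fin N) K (Fin N → K)) (I : Fin m → Fin N)
    (v : ⋀[K]^m (Fin N → K)) (i : Fin m) (j : Fin N) :
    b.repr (pluckerRow b I v i) j = pluckerCoord b (Function.update I i j) v := by
  rw [pluckerRow, Module.Basis.repr_sum_self]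

/-- If `pluckerCoord b I v ≠ 0`, the relations thus force `v` to be a multiple of a pure wedge, with
an explicit spanning family. -/
theorem ιMulti_pluckerRow (b : Module.Basis (Fin N) K (Fin N → K)) (I : Fin m → Fin N)
    {v : ⋀[K]^m (Fin N → K)} (hv : ∀ J, evalForm (pluckerRelation b I J) v = 0) :
    pluckerCoord b I v • exteriorPower.ιMulti K m (pluckerRow b I v) =
      pluckerCoord b I v ^ m • v := by
  refine eq_of_pluckerCoord_eq b fun J => ?_
  have h := hv J
  rw [evalForm_pluckerRelation, sub_eq_zero] at h
  rw [map_smul, map_smul, smul_eq_mul, smul_eq_mul, h, pluckerCoord_ιMulti]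
  congr 2
  ext i j
  simp [coordMatrix_apply, repr_pluckerRow]

/-- For a pure wedge these rows are the rows of `adj A_I * A`, hence combinations of the rows of
`A`. -/
theorem pluckerRow_ιMulti_mem_span (b : Module.Basis (Fin N) K (Fin N → K)) (I : Fin m → Fin N)
    (w : Fin m → Fin N → K) (i : Fin m) :
    pluckerRow b I (exteriorPower.ιMulti K m w) i ∈ Submodule.span K (Set.range w) := by
  have h : pluckerRow b I (exteriorPower.ιMulti K m w) i =
      ∑ l, ((coordMatrix b w).submatrix id I).adjugate i l • w l := by
    refine b.ext_elem fun j => ?_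
    rw [repr_pluckerRow, pluckerCoord_ιMulti, ← adjugate_submatrix_mul_apply,
      Matrix.mul_apply]
    simp [coordMatrix_apply]
  rw [h]
  exact Submodule.sum_mem _ fun l _ => Submodule.smul_mem _ _ (Submodule.subset_span ⟨l, rfl⟩)

end PluckerCoordinates

/-! ### The closure of a Schubert cell -/

section SchubertClosure

/-- Greedy choice: a space of dimension at least `k + 1` is not contained in the span of the `k`
vectors already chosen. -/
theorem exists_linearIndependent_mem {K E : Type*} [Field K] [AddCommGroup E] [Module K E]
    [FiniteDimensional K E] {m : ℕ} (S : Fin m → Submodule K E)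
    (hS : ∀ k : Fin m, (k : ℕ) + 1 ≤ Module.finrank K (S k)) :
    ∃ w : Fin m → E, LinearIndependent K w ∧ ∀ k, w k ∈ S k := by
  induction m with
  | zero => exact ⟨Fin.elim0, linearIndependent_empty_type, fun k => k.elim0⟩
  | succ m ih =>
    obtain ⟨w, hw, hmem⟩ := ih (fun k => S k.castSucc) fun k => hS k.castSucc
    have hlt : ¬ S (Fin.last m) ≤ Submodule.span K (Set.range w) := by
      intro hle
      have h1 := Submodule.finrank_mono hle
      have h2 := hS (Fin.last m)
      rw [finrank_span_eq_card hw, Fintype.card_fin] at h1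
      rw [Fin.val_last] at h2
      omega
    obtain ⟨x, hx, hxw⟩ := Set.not_subset.mp hlt
    refine ⟨Fin.snoc w x, linearIndependent_finSnoc.mpr ⟨hw, hxw⟩, fun k => ?_⟩
    induction k using Fin.lastCases with
    | last => simpa using hx
    | cast k => simpa using hmem k

/-- Only `m - 1 - k` rows lie beyond `k`, so by pigeonhole every term of the Leibniz expansion meets
the zero block. -/
theorem det_eq_zero_of_card {R : Type*} [CommRing R] {m : ℕ} (M : Matrix (Fin m) (Fin m) R)
    (k : Fin m) (J : Finset (Fin m)) (hJ : m < J.card + (k + 1))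
    (hM : ∀ i ≤ k, ∀ j ∈ J, M i j = 0) : M.det = 0 := by
  rw [Matrix.det_apply]
  refine Finset.sum_eq_zero fun τ _ => ?_
  obtain ⟨j, hj, hτ⟩ : ∃ j ∈ J, τ j ≤ k := by
    by_contra! h
    have hcard := Finset.card_le_card_of_injOn (t := Finset.Ioi k) τ
      (fun j hj => by simpa using h j hj) τ.injective.injOn
    rw [Fin.card_Ioi] at hcard
    omega
  have hprod : ∏ i, M (τ i) i = 0 := Finset.prod_eq_zero (Finset.mem_univ j) (hM _ hτ _ hj)
  exact (congrArg _ hprod).trans (smul_zero _)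

variable {K : Type*} [Field K] {m N : ℕ}

theorem CompleteFlag.IsCompatible.mem_iff {𝓕 : CompleteFlag K N}
    {b : Module.Basis (Fin N) K (Fin N → K)} (h : 𝓕.IsCompatible b) {q : ℕ} (hq : q ≤ N)
    (x : Fin N → K) : x ∈ 𝓕.V q ↔ ∀ j : Fin N, q ≤ (j : ℕ) → b.repr x j = 0 := by
  have himg : {x | ∃ i : Fin N, (i : ℕ) < q ∧ x = b i} = b '' {i | (i : ℕ) < q} := by
    ext x
    simp only [Set.mem_ofPred_eq, Set.mem_image, eq_comm]
  rw [h q hq, himg, Module.Basis.mem_span_image]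
  constructor
  · intro hs j hj
    by_contra hne
    exact absurd (hs (Finsupp.mem_support_iff.mpr hne)) (not_lt.mpr hj)
  · intro hs j hj
    by_contra hne
    exact Finsupp.mem_support_iff.mp hj (hs j (not_lt.mp hne))

theorem CompleteFlag.IsCompatible.mem_succ_iff {𝓕 : CompleteFlag K N}
    {b : Module.Basis (Fin N) K (Fin N → K)} (h : 𝓕.IsCompatible b) (q : Fin N)
    (x : Fin N → K) : x ∈ 𝓕.V (q + 1) ↔ ∀ j : Fin N, q < j → b.repr x j = 0 :=
  h.mem_iff q.isLt x

/-- The Schubert cell with the given pivots, parametrized by matrices in reduced echelon form with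
respect to a basis. -/
def schubertCell (b : Module.Basis (Fin N) K (Fin N → K)) (piv : Fin m → Fin N) :
    Set (PluckerSpace K m N) :=
  {p | ∃ w : Fin m → Fin N → K, (∀ i l, b.repr (w i) (piv l) = (1 : Matrix _ _ K) i l) ∧
    (∀ i j, piv i < j → b.repr (w i) j = 0) ∧
    ∃ h, p = Projectivization.mk K (exteriorPower.ιMulti K m w) h}

/-- An echelon family with nonzero pivots has a reduced echelon form. -/
theorem exists_reduced_of_pivots_ne_zero (b : Module.Basis (Fin N) K (Fin N → K))
    {piv : Fin m → Fin N} (hpiv : StrictMono piv) {w : Fin m → Fin N → K}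
    (hw : ∀ i j, piv i < j → b.repr (w i) j = 0) (hd : ∀ i, b.repr (w i) (piv i) ≠ 0) :
    ∃ w' : Fin m → Fin N → K, (∀ i l, b.repr (w' i) (piv l) = (1 : Matrix _ _ K) i l) ∧
      (∀ i j, piv i < j → b.repr (w' i) j = 0) ∧
      ∃ c : K, exteriorPower.ιMulti K m w = c • exteriorPower.ιMulti K m w' := by
  set M := (coordMatrix b w).submatrix id piv
  -- The pivot minor is lower triangular, hence so is its inverse; multiplying by the inverse
  -- normalizes the pivot columns without spoiling the echelon shape.
  have hM : M.BlockTriangular OrderDual.toDual := fun i j hij => hw i _ (hpiv hij)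
  have hdet : IsUnit M.det := by
    rw [Matrix.det_of_isLowerTriangular M hM, isUnit_iff_ne_zero]
    exact Finset.prod_ne_zero_iff.mpr fun i _ => hd i
  have := M.invertibleOfIsUnitDet hdet
  have hinv := Matrix.blockTriangular_inv_of_blockTriangular hM
  have hcoord : coordMatrix b (fun i => ∑ l, M⁻¹ i l • w l) = M⁻¹ * coordMatrix b w := by
    ext i j
    simp [coordMatrix_apply, Matrix.mul_apply]
  refine ⟨fun i => ∑ l, M⁻¹ i l • w l, fun i l => ?_, fun i j hij => ?_, M.det, ?_⟩
  · have h := congrFun (congrFun hcoord i) (piv l)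
    rw [← Matrix.nonsing_inv_mul M hdet]
    exact h
  · refine (congrFun (congrFun hcoord i) j).trans ?_
    rw [Matrix.mul_apply]
    refine Finset.sum_eq_zero fun l _ => ?_
    rcases lt_or_ge i l with hil | hil
    · rw [hinv hil, zero_mul]
    · rw [coordMatrix_apply, hw l j ((hpiv.monotone hil).trans_lt hij), mul_zero]
  · refine eq_of_pluckerCoord_eq b fun I => ?_
    have hsub : (M⁻¹ * coordMatrix b w).submatrix id I =
        M⁻¹ * (coordMatrix b w).submatrix id I := rfl
    rw [map_smul, pluckerCoord_ιMulti, pluckerCoord_ιMulti, hcoord, hsub, Matrix.det_mul,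
      smul_eq_mul, ← mul_assoc, ← Matrix.det_mul, Matrix.mul_nonsing_inv M hdet, Matrix.det_one,
      one_mul]

/-- Induction on the set of rows whose pivot entry vanishes. -/
theorem evalForm_ιMulti_eq_zero [Infinite K] (b : Module.Basis (Fin N) K (Fin N → K))
    {piv : Fin m → Fin N} (hpiv : StrictMono piv) {d : ℕ}
    {F : MvPolynomial (Module.Dual K (⋀[K]^m (Fin N → K))) K} (hF : F.IsHomogeneous d)
    (hcell : ∀ q ∈ schubertCell b piv, VanishesAt F q) (w : Fin m → Fin N → K)
    (hw : ∀ i j, piv i < j → b.repr (w i) j = 0) :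
    evalForm F (exteriorPower.ιMulti K m w) = 0 := by
  classical
  induction hT : (Finset.univ.filter fun i => b.repr (w i) (piv i) = 0) using Finset.strongInduction
    generalizing w with
  | H T ih =>
    by_cases hd : ∀ i, b.repr (w i) (piv i) ≠ 0
    · obtain ⟨w', h1, h2, c, hc⟩ := exists_reduced_of_pivots_ne_zero b hpiv hw hd
      have hne : exteriorPower.ιMulti K m w' ≠ 0 := by
        intro h0
        have hp := pluckerCoord_ιMulti b piv w'
        have hone : (coordMatrix b w').submatrix id piv = 1 := by
          ext i l
          exact h1 i l
        rw [h0, hone, map_zero, Matrix.det_one] at hp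
        exact zero_ne_one hp
      rw [hc, evalForm_smul hF, (vanishesAt_mk hF _ hne).mp (hcell _ ⟨w', h1, h2, hne, rfl⟩),
        mul_zero]
    · push Not at hd
      obtain ⟨k, hk⟩ := hd
      -- Adding `t • b (piv k)` to row `k` moves the wedge along a line, by multilinearity. For `t ≠
      -- 0` it repairs the `k`-th pivot and leaves the other pivots alone.
      refine evalForm_eq_zero_of_punctured_line F _
        (exteriorPower.ιMulti K m (Function.update w k (b (piv k)))) fun t ht => ?_
      have hupd : exteriorPower.ιMulti K m w +
          t • exteriorPower.ιMulti K m (Function.update w k (b (piv k))) =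
          exteriorPower.ιMulti K m (Function.update w k (w k + t • b (piv k))) := by
        rw [AlternatingMap.map_update_add, AlternatingMap.map_update_smul,
          Function.update_eq_self]
      rw [hupd]
      refine ih _ ?_ _ ?_ rfl
      · rw [← hT, Finset.ssubset_iff_of_subset]
        · exact ⟨k, by simpa using hk, by simp [hk, ht]⟩
        · intro i hi
          rw [Finset.mem_filter] at hi ⊢
          refine ⟨Finset.mem_univ _, ?_⟩
          by_cases hik : i = k
          · rw [hik, hk]
          · simpa [hik] using hi.2
      · intro i j hij
        by_cases hik : i = k
        · subst hik
          simp [hw i j hij, hij.ne]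
        · simpa [hik] using hw i j hij

theorem schubertVariety_subset_projectiveClosure [Infinite K] {𝓕 : CompleteFlag K N}
    {b : Module.Basis (Fin N) K (Fin N → K)} (hb : 𝓕.IsCompatible b) {piv : Fin m → Fin N}
    (hpiv : StrictMono piv) :
    schubertVariety 𝓕 (fun k => (piv k : ℕ) + 1) ⊆ projectiveClosure (schubertCell b piv) := by
  rintro _ ⟨U, hU, rfl⟩ d F hF hX
  obtain ⟨w, hw, hmem⟩ := exists_linearIndependent_mem _ hU
  have hspan : Submodule.span K (Set.range w) = U.1 := by
    refine Submodule.eq_of_le_of_finrank_eq ?_ ?_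
    · rw [Submodule.span_le]
      rintro _ ⟨i, rfl⟩
      exact (hmem i).1
    · rw [finrank_span_eq_card hw, Fintype.card_fin, U.2]
  rw [plucker_eq_mk U hspan (ιMulti_ne_zero hw), vanishesAt_mk hF]
  exact evalForm_ιMulti_eq_zero b hpiv hF hX w fun i => (hb.mem_succ_iff (piv i) _).mp (hmem i).2

/-- On the cell, rows up to `k` vanish beyond `piv k`, so these minors contain a zero block that is
too large; being linear forms, they also vanish on the closure. -/
theorem pluckerCoord_eq_zero_of_mem_closure (b : Module.Basis (Fin N) K (Fin N → K))
    {piv : Fin m → Fin N} (hpiv : StrictMono piv) {p : PluckerSpace K m N}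
    (hp : p ∈ projectiveClosure (schubertCell b piv)) (k : Fin m) (I : Fin m → Fin N)
    (hI : m < (Finset.univ.filter fun j => piv k < I j).card + (k + 1)) :
    pluckerCoord b I p.rep = 0 := by
  have h := hp 1 (MvPolynomial.X (pluckerCoord b I)) (MvPolynomial.isHomogeneous_X _ _) ?_
  · simpa [VanishesAt, evalForm] using h
  · rintro _ ⟨w, -, hw, hne, rfl⟩
    rw [vanishesAt_mk (MvPolynomial.isHomogeneous_X _ _), evalForm, MvPolynomial.eval_X,
      pluckerCoord_ιMulti]
    refine det_eq_zero_of_card _ k _ hI fun i hi j hj => ?_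
    exact hw i _ ((hpiv.monotone hi).trans_lt (Finset.mem_filter.mp hj).2)

theorem pluckerRelation_eq_zero_of_mem_closure (b : Module.Basis (Fin N) K (Fin N → K))
    {piv : Fin m → Fin N} {p : PluckerSpace K m N}
    (hp : p ∈ projectiveClosure (schubertCell b piv)) (I J : Fin m → Fin N) :
    evalForm (pluckerRelation b I J) p.rep = 0 := by
  refine hp _ _ (isHomogeneous_pluckerRelation b I J) ?_
  rintro _ ⟨w, -, -, hne, rfl⟩
  rw [vanishesAt_mk (isHomogeneous_pluckerRelation b I J)]
  exact evalForm_pluckerRelation_ιMulti b I J w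

/-- If all Plücker coordinates with too many indices beyond `q` vanish, then the row space meets
the `q`-th step of the flag in a large subspace. -/
theorem le_finrank_inf_of_pluckerCoord (b : Module.Basis (Fin N) K (Fin N → K))
    {w : Fin m → Fin N → K} (hw : exteriorPower.ιMulti K m w ≠ 0) (q : Fin N) (r : ℕ)
    (h : ∀ I, m < (Finset.univ.filter fun j => q < I j).card + r →
      pluckerCoord b I (exteriorPower.ιMulti K m w) = 0)
    (S : Submodule K (Fin N → K)) (hS : ∀ x, (∀ j, q < j → b.repr x j = 0) → x ∈ S) :
    r ≤ Module.finrank K (Submodule.span K (Set.range w) ⊓ S : Submodule K (Fin N → K)) := by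
  classical
  set v := exteriorPower.ιMulti K m w
  have hne : (Finset.univ.filter fun I => pluckerCoord b I v ≠ 0).Nonempty := by
    by_contra hempty
    refine hw (eq_of_pluckerCoord_eq b fun I => ?_)
    by_contra hI
    exact hempty ⟨I, by simpa using hI⟩
  -- Among the nonzero coordinates, take one with the most indices beyond `q`.
  obtain ⟨I, hI, hmax⟩ := Finset.exists_max_image _
    (fun I : Fin m → Fin N => (Finset.univ.filter fun j => q < I j).card) hne
  rw [Finset.mem_filter] at hI
  have hli : LinearIndependent K (pluckerRow b I v) := by
    refine linearIndependent_of_ιMulti_ne_zero fun h0 => ?_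
    have hrow := ιMulti_pluckerRow b I (v := v) fun J => evalForm_pluckerRelation_ιMulti b I J w
    rw [h0, smul_zero] at hrow
    exact smul_ne_zero (pow_ne_zero m hI.2) hw hrow.symm
  have hmem : ∀ i, I i ≤ q → pluckerRow b I v i ∈ S := by
    refine fun i hi => hS _ fun j hj => ?_
    rw [repr_pluckerRow]
    by_contra hcoord
    -- Replacing `I i ≤ q` by `j > q` would raise the maximal count, so that coordinate is zero and
    -- row `i` has no entry beyond `q`.
    refine not_lt.mpr (hmax (Function.update I i j) (by simpa using hcoord))
      (Finset.card_lt_card ?_)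
    rw [Finset.ssubset_iff_of_subset]
    · exact ⟨i, by simpa using hj, by simpa using hi⟩
    · intro l hl
      rw [Finset.mem_filter] at hl ⊢
      refine ⟨Finset.mem_univ _, ?_⟩
      by_cases hli : l = i
      · simpa [hli] using hj
      · simpa [hli] using hl.2
  have hsub := hli.comp (Subtype.val : {i // I i ≤ q} → Fin m) Subtype.val_injective
  have hle : Submodule.span K (Set.range (pluckerRow b I v ∘ (Subtype.val : {i // I i ≤ q} → _))) ≤
      Submodule.span K (Set.range w) ⊓ S := by
    rw [Submodule.span_le]
    rintro _ ⟨i, rfl⟩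
    exact ⟨pluckerRow_ιMulti_mem_span b I w i, hmem i i.2⟩
  have hfin := Submodule.finrank_mono hle
  rw [finrank_span_eq_card hsub, Fintype.card_subtype] at hfin
  have hsplit := Finset.card_filter_add_card_filter_not (s := (Finset.univ : Finset (Fin m)))
    (fun i => I i ≤ q)
  simp only [not_le, Finset.card_univ, Fintype.card_fin] at hsplit
  -- Since the coordinate `I` is nonzero, at least `r` of its indices are at most `q`; the
  -- corresponding rows are independent and lie in `S`.
  have hbound : ¬ m < (Finset.univ.filter fun j => q < I j).card + r := fun hlt => hI.2 (h I hlt)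
  omega

theorem projectiveClosure_subset_schubertVariety {𝓕 : CompleteFlag K N}
    {b : Module.Basis (Fin N) K (Fin N → K)} (hb : 𝓕.IsCompatible b) {piv : Fin m → Fin N}
    (hpiv : StrictMono piv) :
    projectiveClosure (schubertCell b piv) ⊆ schubertVariety 𝓕 (fun k => (piv k : ℕ) + 1) := by
  intro p hp
  obtain ⟨I, hI⟩ : ∃ I, pluckerCoord b I p.rep ≠ 0 := by
    by_contra! h
    exact p.rep_nonzero (eq_of_pluckerCoord_eq b fun I => by rw [h I, map_zero])
  have hrow := ιMulti_pluckerRow b I fun J => pluckerRelation_eq_zero_of_mem_closure b hp I J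
  set w := pluckerRow b I p.rep
  -- The scalar is morally the power `m - 1`, written so that it is also right for `m = 0`.
  obtain ⟨c, hc, hwc⟩ : ∃ c : K, c ≠ 0 ∧ exteriorPower.ιMulti K m w = c • p.rep :=
    ⟨(pluckerCoord b I p.rep)⁻¹ * pluckerCoord b I p.rep ^ m,
      mul_ne_zero (inv_ne_zero hI) (pow_ne_zero m hI), by
        rw [mul_smul, ← hrow, inv_smul_smul₀ hI]⟩
  have hne : exteriorPower.ιMulti K m w ≠ 0 := hwc ▸ smul_ne_zero hc p.rep_nonzero
  obtain ⟨U, hU⟩ : ∃ U : Grass K m N, Submodule.span K (Set.range w) = U.1 :=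
    ⟨⟨Submodule.span K (Set.range w), by
      rw [finrank_span_eq_card (linearIndependent_of_ιMulti_ne_zero hne), Fintype.card_fin]⟩, rfl⟩
  refine ⟨U, fun k => ?_, ?_⟩
  · rw [← hU]
    refine le_finrank_inf_of_pluckerCoord b hne (piv k) _ (fun J hJ => ?_) _
      fun x hx => (hb.mem_succ_iff _ x).mpr hx
    rw [hwc, map_smul, pluckerCoord_eq_zero_of_mem_closure b hpiv hp k J hJ, smul_zero]
  · rw [plucker_eq_mk U hU hne]
    conv_rhs => rw [← p.mk_rep]
    exact (Projectivization.mk_eq_mk_iff' ..).mpr ⟨c, hwc.symm⟩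

theorem projectiveClosure_schubertCell [Infinite K] {𝓕 : CompleteFlag K N}
    {b : Module.Basis (Fin N) K (Fin N → K)} (hb : 𝓕.IsCompatible b) {piv : Fin m → Fin N}
    (hpiv : StrictMono piv) :
    projectiveClosure (schubertCell b piv) = schubertVariety 𝓕 (fun k => (piv k : ℕ) + 1) :=
  (projectiveClosure_subset_schubertVariety hb hpiv).antisymm
    (schubertVariety_subset_projectiveClosure hb hpiv)

end SchubertClosure

/-! ### The column permutation attached to `μ` -/

section ColumnPermutation

variable {m n : ℕ}

/-- The position of the `i`-th pivot column. -/
def pivotPosition (μ : Fin m → ℕ) (hμ : ∀ i, μ i ≤ n) (i : Fin m) : Fin (m + n) :=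
  ⟨μ i + i, by have := hμ i; omega⟩

theorem pivotPosition_strictMono {μ : Fin m → ℕ} (hmono : Monotone μ) (hμ : ∀ i, μ i ≤ n) :
    StrictMono (pivotPosition μ hμ) := by
  intro i l hil
  have h1 := hmono hil.le
  have h2 : (i : ℕ) < l := hil
  simp only [pivotPosition, Fin.mk_lt_mk]
  omega

/-- The number of pivot columns to the left of the `j`-th free column. -/
def pivotsBefore (μ : Fin m → ℕ) (j : ℕ) : ℕ :=
  (Finset.univ.filter fun i => μ i ≤ j).card

theorem pivotsBefore_mono (μ : Fin m → ℕ) : Monotone (pivotsBefore μ) := fun _ _ hjl =>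
  Finset.card_le_card (Finset.monotone_filter_right _ fun _ _ hi => le_trans hi hjl)

theorem pivotsBefore_le (μ : Fin m → ℕ) (j : ℕ) : pivotsBefore μ j ≤ m :=
  (Finset.card_filter_le _ _).trans_eq (by simp)

/-- By monotonicity the indices with `μ i ≤ j` form an initial segment; here `i` is outside it, so
its length is at most `i`. -/
theorem pivotsBefore_le_of_lt {μ : Fin m → ℕ} (hmono : Monotone μ) {i : Fin m} {j : ℕ}
    (h : j < μ i) : pivotsBefore μ j ≤ i := by
  rw [← Fin.card_Iio i]
  refine Finset.card_le_card fun l hl => ?_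
  rw [Finset.mem_Iio]
  by_contra hil
  have := hmono (not_lt.mp hil)
  have := (Finset.mem_filter.mp hl).2
  omega

theorem lt_pivotsBefore_of_le {μ : Fin m → ℕ} (hmono : Monotone μ) {i : Fin m} {j : ℕ}
    (h : μ i ≤ j) : (i : ℕ) < pivotsBefore μ j := by
  rw [Nat.lt_iff_add_one_le, ← Fin.card_Iic i]
  refine Finset.card_le_card fun l hl => ?_
  rw [Finset.mem_filter]
  exact ⟨Finset.mem_univ _, (hmono (Finset.mem_Iic.mp hl)).trans h⟩

/-- There is a permutation of the columns moving the columns of the identity block to the pivot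
positions and keeping the order of the other columns. -/
theorem exists_columnPermutation {μ : Fin m → ℕ} (hmono : Monotone μ) (hμ : ∀ i, μ i ≤ n) :
    ∃ σ : Equiv.Perm (Fin (m + n)), (∀ i, σ (Fin.castAdd n i) = pivotPosition μ hμ i) ∧
      ∀ i (j : Fin n), pivotPosition μ hμ i < σ (Fin.natAdd m j) ↔ μ i ≤ (j : ℕ) := by
  -- The `j`-th free column is shifted right by the number of pivots preceding it.
  let free : Fin n → Fin (m + n) := fun j =>
    ⟨j + pivotsBefore μ j, by have := pivotsBefore_le μ j; omega⟩
  have hlt : ∀ i (j : Fin n), pivotPosition μ hμ i < free j ↔ μ i ≤ (j : ℕ) := by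
    intro i j
    simp only [pivotPosition, free, Fin.mk_lt_mk]
    constructor
    · intro h
      by_contra hj
      have := pivotsBefore_le_of_lt hmono (not_le.mp hj)
      omega
    · intro h
      have := lt_pivotsBefore_of_le hmono h
      omega
  have hne : ∀ i (j : Fin n), pivotPosition μ hμ i ≠ free j := by
    intro i j h
    have h1 : μ i + i = j + pivotsBefore μ j := congrArg Fin.val h
    by_cases hj : μ i ≤ (j : ℕ)
    · have := lt_pivotsBefore_of_le hmono hj
      omega
    · have := pivotsBefore_le_of_lt hmono (not_le.mp hj)
      omega
  have hfree : StrictMono free := by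
    intro j l hjl
    have h1 := pivotsBefore_mono μ hjl.le
    have h2 : (j : ℕ) < l := hjl
    simp only [free, Fin.mk_lt_mk]
    omega
  have hinj : Function.Injective
      (Sum.elim (pivotPosition μ hμ) free ∘ (finSumFinEquiv (m := m) (n := n)).symm) :=
    ((pivotPosition_strictMono hmono hμ).injective.sumElim hfree.injective hne).comp
      finSumFinEquiv.symm.injective
  refine ⟨Equiv.ofBijective _ (Finite.injective_iff_bijective.mp hinj), fun i => ?_,
    fun i j => ?_⟩
  · simp
  · simpa using hlt i j

end ColumnPermutation

/-! ### From the linear space to the Schubert cell -/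

section Compactification

variable {K : Type*} [Field K] {m n N : ℕ}

theorem IsLowerLeftFilled.mem_iff {μ : Fin m → ℕ} {𝓛 : Submodule K (Matrix (Fin m) (Fin n) K)}
    (h : IsLowerLeftFilled μ 𝓛) (F : Matrix (Fin m) (Fin n) K) :
    F ∈ 𝓛 ↔ ∀ i (j : Fin n), μ i ≤ (j : ℕ) → F i j = 0 := by
  constructor
  · intro hF i j hj
    rw [h.eq_span] at hF
    induction hF using Submodule.span_induction with
    | mem x hx =>
      obtain ⟨i', j', hlt, rfl⟩ := hx
      refine Matrix.single_apply_of_ne _ _ _ _ _ ?_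
      rintro ⟨rfl, rfl⟩
      omega
    | zero => rfl
    | add x y _ _ hx hy => rw [Matrix.add_apply, hx, hy, add_zero]
    | smul a x _ hx => rw [Matrix.smul_apply, hx, smul_zero]
  · intro hF
    rw [h.eq_span, Matrix.matrix_eq_sum_single F]
    refine Submodule.sum_mem _ fun i _ => Submodule.sum_mem _ fun j _ => ?_
    by_cases hj : μ i ≤ (j : ℕ)
    · rw [hF i j hj, Matrix.single_zero]
      exact Submodule.zero_mem _
    · have hs : Matrix.single i j (F i j) = F i j • Matrix.single i j (1 : K) := by
        rw [Matrix.smul_single, smul_eq_mul, mul_one]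
      rw [hs]
      exact Submodule.smul_mem _ _ (Submodule.subset_span ⟨i, j, by omega, rfl⟩)

theorem augment_castAdd (F : Matrix (Fin m) (Fin n) K) (i l : Fin m) :
    augment F i (Fin.castAdd n l) = (1 : Matrix _ _ K) i l := by
  simp [augment]

theorem augment_natAdd (F : Matrix (Fin m) (Fin n) K) (i : Fin m) (j : Fin n) :
    augment F i (Fin.natAdd m j) = F i j := by
  simp [augment]

theorem repr_columnPermutation (σ : Equiv.Perm (Fin N))
    (b : Module.Basis (Fin N) K (Fin N → K)) (x : Fin N → K) (j : Fin N) :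
    b.repr (columnPermutation σ b x) (σ j) = x j := by
  have h : b.coord (σ j) ∘ₗ (columnPermutation σ b : (Fin N → K) →ₗ[K] (Fin N → K)) =
      LinearMap.proj j := by
    refine (Pi.basisFun K (Fin N)).ext fun i => ?_
    rw [LinearMap.comp_apply, LinearEquiv.coe_coe, columnPermutation, Module.Basis.equiv_apply]
    simp [Finsupp.single_apply, Pi.single_apply, eq_comm]
  exact LinearMap.congr_fun h x

/-- The linear automorphism of the exterior power induced by a linear automorphism. -/
noncomputable def exteriorPowerEquiv (m : ℕ) (g : (Fin N → K) ≃ₗ[K] (Fin N → K)) :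
    (⋀[K]^m (Fin N → K)) ≃ₗ[K] (⋀[K]^m (Fin N → K)) :=
  LinearEquiv.ofBijective (exteriorPower.map m (g : (Fin N → K) →ₗ[K] (Fin N → K)))
    ⟨exteriorPower.map_injective_field g.injective, exteriorPower.map_surjective g.surjective⟩

theorem inducedMap_plucker_rowspAugment (g : (Fin (m + n) → K) ≃ₗ[K] (Fin (m + n) → K))
    (F : Matrix (Fin m) (Fin n) K) :
    ∃ h, inducedMap m g (plucker (rowspAugment F)) =
      Projectivization.mk K (exteriorPower.ιMulti K m fun i => g (augment F i)) h := by
  have hli : LinearIndependent K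
      ((g : (Fin (m + n) → K) →ₗ[K] (Fin (m + n) → K)) ∘ (augment F).row) :=
    LinearIndependent.map' (linearIndependent_augment F) _ (LinearEquiv.ker g)
  refine ⟨ιMulti_ne_zero hli, ?_⟩
  rw [plucker_eq_mk (rowspAugment F) rfl (ιMulti_ne_zero (linearIndependent_augment F)),
    inducedMap, Projectivization.map_mk]
  simp only [exteriorPower.map_apply_ιMulti]
  rfl

/-- By `hσ` the identity block fills the pivot columns. By `hσ'` the zeros demanded by the echelon
shape in the free columns are those defining `𝓛`, so `F` can be read back from a reduced echelon
family. -/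
theorem inducedMap_image_eq_schubertCell {μ : Fin m → ℕ}
    {𝓛 : Submodule K (Matrix (Fin m) (Fin n) K)} (h : IsLowerLeftFilled μ 𝓛)
    {σ : Equiv.Perm (Fin (m + n))}
    (hσ : ∀ i, σ (Fin.castAdd n i) = pivotPosition μ h.le i)
    (hσ' : ∀ i (j : Fin n), pivotPosition μ h.le i < σ (Fin.natAdd m j) ↔ μ i ≤ (j : ℕ))
    (b : Module.Basis (Fin (m + n)) K (Fin (m + n) → K)) :
    inducedMap m (columnPermutation σ b) '' ((fun F => plucker (rowspAugment F)) '' 𝓛) =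
      schubertCell b (pivotPosition μ h.le) := by
  ext p
  constructor
  · rintro ⟨_, ⟨F, hF, rfl⟩, rfl⟩
    obtain ⟨hne, heq⟩ := inducedMap_plucker_rowspAugment (columnPermutation σ b) F
    refine ⟨_, fun i l => ?_, fun i j hij => ?_, hne, heq⟩
    · rw [← hσ, repr_columnPermutation, augment_castAdd]
    · obtain ⟨j, rfl⟩ := σ.surjective j
      rw [repr_columnPermutation]
      induction j using Fin.addCases with
      | left l =>
        rw [hσ] at hij
        rw [augment_castAdd, Matrix.one_apply_ne]
        rintro rfl
        exact lt_irrefl _ hij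
      | right j =>
        rw [augment_natAdd]
        exact (h.mem_iff F).mp hF i j ((hσ' i j).mp hij)
  · rintro ⟨w, hw, hw', hne, rfl⟩
    let F : Matrix (Fin m) (Fin n) K := Matrix.of fun i j => b.repr (w i) (σ (Fin.natAdd m j))
    refine ⟨_, ⟨F, (h.mem_iff F).mpr fun i j hj => hw' i _ ((hσ' i j).mpr hj), rfl⟩, ?_⟩
    obtain ⟨hne', heq⟩ := inducedMap_plucker_rowspAugment (columnPermutation σ b) F
    have hrow : (fun i => columnPermutation σ b (augment F i)) = w := by
      funext i
      refine b.ext_elem fun j => ?_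
      obtain ⟨j, rfl⟩ := σ.surjective j
      rw [repr_columnPermutation]
      induction j using Fin.addCases with
      | left l => rw [augment_castAdd, hσ, hw]
      | right j => rw [augment_natAdd]; rfl
    simp only [heq, hrow]

/-- Choose a vector in each flag step outside the previous one; the dimensions show that these
vectors span every step. -/
theorem CompleteFlag.exists_isCompatible (𝓕 : CompleteFlag K N) :
    ∃ b : Module.Basis (Fin N) K (Fin N → K), 𝓕.IsCompatible b := by
  have hex : ∀ i : Fin N, ∃ x, x ∈ 𝓕.V (i + 1) ∧ x ∉ 𝓕.V i := by
    intro i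
    refine Set.not_subset.mp fun hle => ?_
    have h := Submodule.finrank_mono (R := K) (s := 𝓕.V (i + 1)) (t := 𝓕.V i) hle
    rw [𝓕.finrank_eq _ i.isLt, 𝓕.finrank_eq _ i.isLt.le] at h
    omega
  choose x hx hx' using hex
  have hspan : ∀ q, q ≤ N →
      𝓕.V q = Submodule.span K {y | ∃ i : Fin N, (i : ℕ) < q ∧ y = x i} := by
    intro q
    induction q with
    | zero =>
      intro h
      simpa using Submodule.finrank_eq_zero.mp (𝓕.finrank_eq 0 h)
    | succ q ih =>
      intro h
      have hlt : 𝓕.V q < Submodule.span K {y | ∃ i : Fin N, (i : ℕ) < q + 1 ∧ y = x i} := by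
        refine lt_of_le_of_ne ?_ fun heq => hx' ⟨q, h⟩ ?_
        · rw [ih (by omega)]
          exact Submodule.span_mono fun y ⟨i, hi, hy⟩ => ⟨i, by omega, hy⟩
        · change x ⟨q, h⟩ ∈ 𝓕.V q
          rw [heq]
          exact Submodule.subset_span ⟨⟨q, h⟩, Nat.lt_succ_self q, rfl⟩
      have hfin := Submodule.finrank_lt_finrank_of_lt hlt
      rw [𝓕.finrank_eq q (by omega)] at hfin
      symm
      refine Submodule.eq_of_le_of_finrank_le ?_ (by rw [𝓕.finrank_eq _ h]; omega)
      rw [Submodule.span_le]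
      rintro _ ⟨i, hi, rfl⟩
      exact 𝓕.mono (by omega) (hx i)
  have htop : ⊤ ≤ Submodule.span K (Set.range x) := by
    have h1 : 𝓕.V N = ⊤ := Submodule.eq_top_of_finrank_eq (by simp [𝓕.finrank_eq N le_rfl])
    rw [← h1, hspan N le_rfl]
    refine Submodule.span_mono ?_
    rintro _ ⟨i, -, rfl⟩
    exact ⟨i, rfl⟩
  refine ⟨basisOfTopLeSpanOfCardEqFinrank x htop (by simp), fun q hq => ?_⟩
  rw [coe_basisOfTopLeSpanOfCardEqFinrank]
  exact hspan q hq

end Compactification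

end SchubertCompactification

theorem mainTheorem7 {K : Type*} [Field K] [IsAlgClosed K] [CharZero K] {m n : ℕ}
    (μ : Fin m → ℕ) (𝓛 : Submodule K (Matrix (Fin m) (Fin n) K))
    (h𝓛 : IsLowerLeftFilled μ 𝓛) :
    (∀ 𝓕 : CompleteFlag K (m + n),
      AreIsomorphic (compactification 𝓛)
        (schubertVariety 𝓕 (fun i : Fin m => μ i + ((i : ℕ) + 1)))) ∧
    ∃ σ : Equiv.Perm (Fin (m + n)),
      ∀ (𝓕 : CompleteFlag K (m + n)) (b : Module.Basis (Fin (m + n)) K (Fin (m + n) → K)),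
        𝓕.IsCompatible b →
        ∃ e : compactification 𝓛 ≃
            schubertVariety 𝓕 (fun i : Fin m => μ i + ((i : ℕ) + 1)),
          IsIsomorphism e ∧
          ∀ p : compactification 𝓛,
            (e p : PluckerSpace K m (m + n)) =
              inducedMap m (columnPermutation σ b) (p : PluckerSpace K m (m + n)) := by
  obtain ⟨σ, hσ, hσ'⟩ := exists_columnPermutation h𝓛.mono h𝓛.le
  have key : ∀ (𝓕 : CompleteFlag K (m + n))
      (b : Module.Basis (Fin (m + n)) K (Fin (m + n) → K)), 𝓕.IsCompatible b →
      ∃ e : compactification 𝓛 ≃ schubertVariety 𝓕 (fun i : Fin m => μ i + ((i : ℕ) + 1)),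
        IsIsomorphism e ∧ ∀ p : compactification 𝓛, (e p : PluckerSpace K m (m + n)) =
          inducedMap m (columnPermutation σ b) (p : PluckerSpace K m (m + n)) := by
    intro 𝓕 b hb
    refine exists_isIsomorphism_of_image_eq (exteriorPowerEquiv m (columnPermutation σ b)) ?_
    rw [compactification, projectivizationEquiv_image_projectiveClosure]
    refine (congrArg projectiveClosure
      (inducedMap_image_eq_schubertCell h𝓛 hσ hσ' b)).trans ?_
    -- Pivots are counted from `0`, so `(μ i + i) + 1` is by definition the Schubert index `μ i + (i
    -- + 1)`.
    exact projectiveClosure_schubertCell hb (pivotPosition_strictMono h𝓛.mono h𝓛.le)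
  refine ⟨fun 𝓕 => ?_, σ, key⟩
  obtain ⟨b, hb⟩ := 𝓕.exists_isCompatible
  obtain ⟨e, he, -⟩ := key 𝓕 b hb
  exact ⟨e, he⟩
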